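/- Let $A$ be a commutative Noetherian ring, $M$ a finitely generated $A$-module and $I\subseteq A$ an ideal with $IM\neq M$. An $M$-regular sequence in $I$ is a finite (possibly empty) sequence $a_1,\dots,a_r$ of elements of $I$ such that, for each $i$, multiplication by $a_i$ is injective on $M/\langle a_1,\dots,a_{i-1}\rangle M$; it is maximal if no $a\in I$ makes $a_1,\dots,a_r,a$ an $M$-regular sequence. For a closed subset $Z$ of a topological space $X$ and a sheaf of abelian groups $\mathscr{F}$ on $X$, put $\Gamma_Z(X,\mathscr{F})=\ker\big(\mathscr{F}(X)\to\mathscr{F}(X\setminus Z)\big)$, let $H^p_Z(X,-)$ be the right derived functors of $\Gamma_Z(X,-)$ from sheaves of abelian groups on $X$ to abelian groups, and let $H^p_I(M)=H^p_{V(I)}(\operatorname{Spec}A,\tilde M)$ be the local cohomology groups of $M$ with respect to $I$, where $\tilde M$ is the quasi-coherent sheaf on $\operatorname{Spec} A$ associated to $M$. Then maximal $M$-regular sequences in $I$ exist and all have the same length; this common length, which is also the supremum of the lengths of all $M$-regular sequences in $I$, is denoted $\operatorname{depth}_I M$. For every integer $n\ge 0$, $$\operatorname{depth}_I M\ge n\quad\Longleftrightarrow\quad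 H^p_I(M)=0\ \text{ for all } 0\le p<n .$$ -/

import Mathlib

open CategoryTheory TopologicalSpace Opposite

universe u

noncomputable section

namespace TopCat.Sheaf

variable {X : TopCat.{u}}

/-- The group `Γ_Z(X, F) = ker (F(X) → F(X ∖ Z))` of sections of the sheaf of abelian groups `F`
with support in the closed subset `Z`. -/
def sectionsWithSupport (Z : Closeds X) (F : TopCat.Sheaf AddCommGrpCat.{u} X) :
    AddSubgroup (F.obj.obj (op ⊤)) :=
  (F.obj.map (homOfLE (le_top : Z.compl ≤ ⊤)).op).hom.ker

lemma map_mem_sectionsWithSupport (Z : Closeds X) {F G : TopCat.Sheaf AddCommGrpCat.{u} X}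
    (f : F ⟶ G) (s : F.obj.obj (op ⊤)) (hs : s ∈ sectionsWithSupport Z F) :
    (f.hom.app (op ⊤)).hom s ∈ sectionsWithSupport Z G := by
  have h := ConcreteCategory.congr_hom
    (f.hom.naturality (homOfLE (le_top : Z.compl ≤ ⊤)).op) s
  have hs' : F.obj.map (homOfLE (le_top : Z.compl ≤ ⊤)).op s = 0 := hs
  change G.obj.map (homOfLE (le_top : Z.compl ≤ ⊤)).op (f.hom.app (op ⊤) s) = 0
  simp only [ConcreteCategory.comp_apply] at h
  rw [← h, hs', map_zero]

/-- The functor `Γ_Z(X, -)` from sheaves of abelian groups on `X` to abelian groups. -/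
def ΓSupport (Z : Closeds X) : TopCat.Sheaf AddCommGrpCat.{u} X ⥤ AddCommGrpCat.{u} where
  obj F := AddCommGrpCat.of (sectionsWithSupport Z F)
  map {F G} f := AddCommGrpCat.ofHom
    (((f.hom.app (op ⊤)).hom.comp (sectionsWithSupport Z F).subtype).codRestrict
      (sectionsWithSupport Z G) fun s => map_mem_sectionsWithSupport Z f s.1 s.2)
  map_id _ := rfl
  map_comp _ _ := rfl

instance (Z : Closeds X) : (ΓSupport Z).Additive where
  map_add := rfl

/-- The cohomology groups `H^p_Z(X, -)` with support in the closed subset `Z`: the right derived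
functors of `Γ_Z(X, -)` on the category of sheaves of abelian groups. -/
def cohomologyWithSupport (Z : Closeds X) (p : ℕ) :
    TopCat.Sheaf AddCommGrpCat.{u} X ⥤ AddCommGrpCat.{u} :=
  (ΓSupport Z).rightDerived p

end TopCat.Sheaf

section LocalCohomology

variable {A : Type u} [CommRing A] (I : Ideal A) (M : Type u) [AddCommGroup M] [Module A M]

/-- The sheaf of abelian groups on `Spec A` underlying the quasi-coherent sheaf attached to the
`A`-module `M`. -/
def tildeAbSheaf :
    TopCat.Sheaf AddCommGrpCat.{u} (AlgebraicGeometry.Spec (CommRingCat.of A)).toTopCat where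
  obj := (AlgebraicGeometry.tilde (R := CommRingCat.of A) (ModuleCat.of A M)).presheaf
  property := (AlgebraicGeometry.tilde (R := CommRingCat.of A) (ModuleCat.of A M)).isSheaf

/-- The closed subset `V(I)` of `Spec A`. -/
def closedZeroLocus : Closeds (AlgebraicGeometry.Spec (CommRingCat.of A)).toTopCat where
  carrier := PrimeSpectrum.zeroLocus (I : Set A)
  isClosed' := PrimeSpectrum.isClosed_zeroLocus (I : Set A)

/-- The local cohomology group `H^p_I(M) = H^p_{V(I)}(Spec A, M^~)`. -/
def sheafLocalCohomology (p : ℕ) : AddCommGrpCat.{u} :=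
  (TopCat.Sheaf.cohomologyWithSupport (closedZeroLocus I) p).obj (tildeAbSheaf M (A := A))

end LocalCohomology

section Depth

variable {A : Type*} [CommRing A] (I : Ideal A) (M : Type*) [AddCommGroup M] [Module A M]

/-- `a₁, …, aₙ` is an `M`-regular sequence in `I`: each `aᵢ` lies in `I` and is not a zero-divisor
on `M ⧸ (a₁, …, aᵢ₋₁) M`. -/
def IsRegularSeqIn (rs : List A) : Prop :=
  (∀ a ∈ rs, a ∈ I) ∧ RingTheory.Sequence.IsWeaklyRegular M rs

/-- An `M`-regular sequence in `I` which cannot be prolonged to a longer one. -/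
def IsMaximalRegularSeqIn (rs : List A) : Prop :=
  IsRegularSeqIn I M rs ∧ ∀ a, ¬ IsRegularSeqIn I M (rs ++ [a])

/-- The depth of `M` with respect to `I`: the supremum of the lengths of the `M`-regular
sequences in `I`. -/
def depth : ℕ∞ :=
  ⨆ (rs : List A) (_ : IsRegularSeqIn I M rs), (rs.length : ℕ∞)

end Depth

end

noncomputable section

/-! ### Right derived functors of a corepresentable functor as Ext groups. -/

namespace CategoryTheory

open Limits Abelian

universe v w

variable {C : Type u} [Category.{v} C] [Abelian C]

/-! With `Z = V(I)`, the functor `Γ_Z` is corepresented by `ℤ_Z = coker(ℤ_{X∖Z} ⟶ ℤ_X)`, so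
`H^p_I(M)` vanishes iff `Ext^p(ℤ_Z, M^~)` does, and the long exact sequences of Ext become
available.

The crux is that every class in `H^p_I(M)` is killed by a power of each `a ∈ I`
(`LocalExt.exists_map_pow_smul_eq_zero`). For `p = 0` this is localization at `a`. In higher degrees
one embeds `M` in an injective module `J` and shifts dimension, which works because `J^~` is flasque
over a noetherian ring, by Artin–Rees.

For `a ∈ I` regular on `M`, use `0 → M → M → M/aM → 0`. If `H^{p-1}_I(M/aM) = 0`, then `a` is
injective on the torsion group `H^p_I(M)`, which is therefore zero. Hence a regular sequence of
length `r` kills all degrees below `r`. Conversely, vanishing up to degree `r` passes to `M/aM` up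
to degree `r - 1`, and vanishing of `H^0_I` yields a regular element by prime avoidance, so a
sequence of length `r` extends. Both claims about depth follow by comparing lengths. -/

lemma Abelian.Ext.subsingleton_zero_iff [HasExt.{w} C] (K F : C) :
    Subsingleton (Ext K F 0) ↔ Subsingleton (K ⟶ F) :=
  Ext.homEquiv₀.subsingleton_congr

variable [HasInjectiveResolutions C] [HasExt.{w} C]

/-- The right derived functors of a functor corepresented by `K` vanish exactly where the
`Ext`-groups out of `K` do. -/
theorem Functor.isZero_rightDerived_obj_iff_subsingleton_ext
    {T : C ⥤ AddCommGrpCat.{v}} [T.Additive] {K : C}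
    (e : T ≅ preadditiveCoyoneda.obj (op K)) (F : C) (p : ℕ) :
    IsZero ((T.rightDerived p).obj F) ↔ Subsingleton (Ext K F p) := by
  let R := injectiveResolution F
  rw [(R.isoRightDerivedObj T p).isZero_iff, ((HomologicalComplex.homologyFunctor _ _ p).mapIso
    ((NatIso.mapHomologicalComplex e (ComplexShape.up ℕ)).app R.cocomplex)).isZero_iff]
  change IsZero (HomologicalComplex.homology _ p) ↔ _
  rw [← HomologicalComplex.exactAt_iff_isZero_homology]
  cases p with
  | zero =>
    -- Degree `0` has no predecessor, so its previous index is `0` itself and the incoming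
    -- differential `d 0 0` is zero.
    rw [HomologicalComplex.exactAt_iff' _ 0 0 1 (by simp) (by simp), ShortComplex.ab_exact_iff,
      Ext.subsingleton_zero_iff]
    have hd (g : K ⟶ R.cocomplex.X 0) : g ≫ R.cocomplex.d 0 0 = 0 := by
      rw [R.cocomplex.shape 0 0 (by simp), comp_zero]
    have hι : Mono R.kernelFork.ι := mono_of_isLimit_fork R.isLimitKernelFork
    change _ ↔ Subsingleton (K ⟶ R.kernelFork.pt)
    constructor
    · refine fun h => subsingleton_of_forall_eq 0 fun f => ?_
      obtain ⟨g, hg⟩ := h (f ≫ R.kernelFork.ι : K ⟶ R.cocomplex.X 0) (by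
        change (f ≫ R.kernelFork.ι) ≫ R.cocomplex.d 0 1 = 0
        rw [Category.assoc, KernelFork.condition, comp_zero])
      rw [← cancel_mono R.kernelFork.ι, zero_comp]
      exact hg.symm.trans (hd g)
    · intro h (f : K ⟶ R.cocomplex.X 0) (hf : f ≫ R.cocomplex.d 0 1 = 0)
      refine ⟨(0 : K ⟶ R.cocomplex.X 0), (hd 0).trans ?_⟩
      obtain ⟨l, hl⟩ := KernelFork.IsLimit.lift' R.isLimitKernelFork f hf
      rw [← hl, h.elim l 0, zero_comp]
  | succ p =>
    rw [HomologicalComplex.exactAt_iff' _ p (p + 1) (p + 2) (by simp) (by simp),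
      ShortComplex.ab_exact_iff]
    constructor
    · refine fun h => subsingleton_of_forall_eq 0 fun x => ?_
      obtain ⟨f, hf, rfl⟩ := R.extMk_surjective x (p + 2) rfl
      exact (R.extMk_eq_zero_iff f _ rfl hf p rfl).2 (h f hf)
    · intro h f hf
      exact (R.extMk_eq_zero_iff f _ rfl hf p rfl).1 (h.elim _ _)

end CategoryTheory

/-! ### Corepresenting sections with support; flasque sheaves. -/

namespace TopCat.Sheaf

open Limits Abelian

variable {X : TopCat.{u}}

lemma hom_naturality_apply {F G : TopCat.Sheaf AddCommGrpCat.{u} X} (f : F ⟶ G)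
    {U V : (Opens X)ᵒᵖ} (i : U ⟶ V) (s : F.obj.obj U) :
    f.hom.app V (F.obj.map i s) = G.obj.map i (f.hom.app U s) :=
  ConcreteCategory.congr_hom (f.hom.naturality i) s

variable (X) in
/-- The free abelian sheaf functor is left adjoint to the forgetful functor from abelian sheaves
to presheaves of types. -/
def freeAdjunction :
    (Functor.whiskeringRight (Opens X)ᵒᵖ _ _).obj AddCommGrpCat.free.{u} ⋙
      presheafToSheaf (Opens.grothendieckTopology X) AddCommGrpCat.{u} ⊣
    sheafToPresheaf (Opens.grothendieckTopology X) AddCommGrpCat.{u} ⋙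
      (Functor.whiskeringRight (Opens X)ᵒᵖ _ _).obj (CategoryTheory.forget AddCommGrpCat.{u}) :=
  (AddCommGrpCat.adj.whiskerRight _).comp (sheafificationAdjunction _ _)

variable (X) in
/-- The functor sending an open subset `U` to the sheaf `ℤ_U`, the extension by zero of the
constant sheaf `ℤ` on `U`. -/
def freeOpen : Opens X ⥤ TopCat.Sheaf AddCommGrpCat.{u} X :=
  yoneda ⋙ (Functor.whiskeringRight (Opens X)ᵒᵖ _ _).obj AddCommGrpCat.free.{u} ⋙
    presheafToSheaf (Opens.grothendieckTopology X) AddCommGrpCat.{u}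

/-- Morphisms `ℤ_U ⟶ F` are the sections of `F` over `U`. -/
def freeOpenEquiv (U : Opens X) (F : TopCat.Sheaf AddCommGrpCat.{u} X) :
    ((freeOpen X).obj U ⟶ F) ≃ F.obj.obj (op U) :=
  ((freeAdjunction X).homEquiv (yoneda.obj U) F).trans yonedaEquiv

lemma freeOpenEquiv_comp {U : Opens X} {F G : TopCat.Sheaf AddCommGrpCat.{u} X}
    (f : (freeOpen X).obj U ⟶ F) (g : F ⟶ G) :
    freeOpenEquiv U G (f ≫ g) = g.hom.app (op U) (freeOpenEquiv U F f) := by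
  exact (congr_arg yonedaEquiv ((freeAdjunction X).homEquiv_naturality_right f g)).trans
    (yonedaEquiv_comp _ _)

lemma freeOpenEquiv_map_comp {U V : Opens X} (i : V ⟶ U) {F : TopCat.Sheaf AddCommGrpCat.{u} X}
    (f : (freeOpen X).obj U ⟶ F) :
    freeOpenEquiv V F ((freeOpen X).map i ≫ f) = F.obj.map i.op (freeOpenEquiv U F f) := by
  exact (congr_arg yonedaEquiv
    ((freeAdjunction X).homEquiv_naturality_left (yoneda.map i) f)).trans
    (yonedaEquiv_naturality _ i).symm

/-- The adjunction is one of sets only; additivity comes from Yoneda, since `f` corresponds to its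
value on the universal section of `ℤ_U`. -/
lemma freeOpenEquiv_add {U : Opens X} {F : TopCat.Sheaf AddCommGrpCat.{u} X}
    (f g : (freeOpen X).obj U ⟶ F) :
    freeOpenEquiv U F (f + g) = freeOpenEquiv U F f + freeOpenEquiv U F g := by
  have h (f : (freeOpen X).obj U ⟶ F) :
      freeOpenEquiv U F f = f.hom.app (op U) (freeOpenEquiv U _ (𝟙 _)) := by
    rw [← freeOpenEquiv_comp, Category.id_comp]
  rw [h, h f, h g]
  rfl

lemma freeOpenEquiv_zero (U : Opens X) (F : TopCat.Sheaf AddCommGrpCat.{u} X) :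
    freeOpenEquiv U F 0 = 0 := by
  simpa using freeOpenEquiv_add (0 : (freeOpen X).obj U ⟶ F) 0

/-- Yoneda, free abelian groups and sheafification all preserve monomorphisms. This lets maps to an
injective sheaf extend from `ℤ_V` to `ℤ_U`. -/
instance mono_freeOpen_map {U V : Opens X} (i : V ⟶ U) : Mono ((freeOpen X).map i) := by
  change Mono ((presheafToSheaf (Opens.grothendieckTopology X) AddCommGrpCat.{u}).map
    (Functor.whiskerRight (yoneda.map i) AddCommGrpCat.free))
  infer_instance

/-- Injective abelian sheaves are flasque. -/
lemma isFlasque_of_injective (E : TopCat.Sheaf AddCommGrpCat.{u} X) [Injective E] :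
    IsFlasque E where
  epi {U V} i := by
    refine (AddCommGrpCat.epi_iff_surjective _).2 fun s => ?_
    obtain ⟨f, hf⟩ := (freeOpenEquiv V.unop E).surjective s
    refine ⟨freeOpenEquiv U.unop E (Injective.factorThru f ((freeOpen X).map i.unop)), ?_⟩
    rw [← hf]
    refine (freeOpenEquiv_map_comp i.unop _).symm.trans ?_
    rw [Injective.comp_factorThru]

/-- The sheaf `ℤ_Z`, the constant sheaf `ℤ` on the closed subset `Z`, extended by zero. -/
def freeClosed (Z : Closeds X) : TopCat.Sheaf AddCommGrpCat.{u} X :=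
  cokernel ((freeOpen X).map (homOfLE (le_top : Z.compl ≤ ⊤)))

/-- The quotient map `ℤ_X ⟶ ℤ_Z`. -/
def freeClosedπ (Z : Closeds X) : (freeOpen X).obj ⊤ ⟶ freeClosed Z :=
  cokernel.π _

lemma freeOpen_map_comp_freeClosedπ (Z : Closeds X) :
    (freeOpen X).map (homOfLE (le_top : Z.compl ≤ ⊤)) ≫ freeClosedπ Z = 0 :=
  cokernel.condition _

instance (Z : Closeds X) : Epi (freeClosedπ Z) := by
  unfold freeClosedπ freeClosed; infer_instance

lemma freeOpenEquiv_mem_sectionsWithSupport {Z : Closeds X}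
    {F : TopCat.Sheaf AddCommGrpCat.{u} X} (f : (freeOpen X).obj ⊤ ⟶ F) :
    freeOpenEquiv ⊤ F f ∈ sectionsWithSupport Z F ↔
      (freeOpen X).map (homOfLE (le_top : Z.compl ≤ ⊤)) ≫ f = 0 := by
  rw [← (freeOpenEquiv _ F).apply_eq_iff_eq, freeOpenEquiv_map_comp, freeOpenEquiv_zero]
  rfl

/-- Morphisms `ℤ_Z ⟶ F` are the sections of `F` with support in `Z`. -/
def freeClosedEquiv (Z : Closeds X) (F : TopCat.Sheaf AddCommGrpCat.{u} X) :
    (freeClosed Z ⟶ F) ≃+ sectionsWithSupport Z F where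
  toFun f := ⟨freeOpenEquiv ⊤ F (freeClosedπ Z ≫ f), by
    rw [freeOpenEquiv_mem_sectionsWithSupport, ← Category.assoc, freeOpen_map_comp_freeClosedπ,
      zero_comp]⟩
  invFun s := cokernel.desc _ ((freeOpenEquiv ⊤ F).symm s) (by
    rw [← freeOpenEquiv_mem_sectionsWithSupport, Equiv.apply_symm_apply]
    exact s.2)
  left_inv f := (cancel_epi (freeClosedπ Z)).1
    ((cokernel.π_desc _ _ _).trans (Equiv.symm_apply_apply _ _))
  right_inv s := Subtype.ext
    ((congr_arg (freeOpenEquiv ⊤ F) (cokernel.π_desc _ _ _)).trans (Equiv.apply_symm_apply _ _))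
  map_add' f g := Subtype.ext
    ((congr_arg (freeOpenEquiv ⊤ F) (Preadditive.comp_add _ _ _ _ _ _)).trans
      (freeOpenEquiv_add _ _))

lemma freeClosedEquiv_comp {Z : Closeds X} {F G : TopCat.Sheaf AddCommGrpCat.{u} X}
    (f : freeClosed Z ⟶ F) (g : F ⟶ G) :
    (freeClosedEquiv Z G (f ≫ g) : G.obj.obj (op ⊤)) =
      g.hom.app (op ⊤) (freeClosedEquiv Z F f : F.obj.obj (op ⊤)) := by
  change freeOpenEquiv ⊤ G (freeClosedπ Z ≫ f ≫ g) = _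
  rw [← Category.assoc, freeOpenEquiv_comp]
  rfl

/-- The functor `Γ_Z(X, -)` is corepresented by `ℤ_Z`. -/
def ΓSupportIso (Z : Closeds X) :
    ΓSupport Z ≅ preadditiveCoyoneda.obj (op (freeClosed Z)) :=
  (NatIso.ofComponents (fun F => (freeClosedEquiv Z F).toAddCommGrpIso) (by
    intro F G g
    ext f
    exact Subtype.ext (freeClosedEquiv_comp f g))).symm

lemma isZero_cohomologyWithSupport_iff (Z : Closeds X) (F : TopCat.Sheaf AddCommGrpCat.{u} X)
    (p : ℕ) :
    IsZero ((cohomologyWithSupport Z p).obj F) ↔ Subsingleton (Ext (freeClosed Z) F p) :=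
  Functor.isZero_rightDerived_obj_iff_subsingleton_ext (ΓSupportIso Z) F p

/-- Sections with support lift along an epimorphism with flasque kernel. -/
lemma exists_lift_freeClosed (Z : Closeds X) {S : ShortComplex (TopCat.Sheaf AddCommGrpCat.{u} X)}
    (hS : S.ShortExact) [IsFlasque S.X₁] (q : freeClosed Z ⟶ S.X₃) :
    ∃ e : freeClosed Z ⟶ S.X₂, e ≫ S.g = q := by
  let s := freeClosedEquiv Z S.X₃ q
  obtain ⟨t, ht⟩ := (AddCommGrpCat.epi_iff_surjective _).1
    (IsFlasque.epi_of_shortExact (U := ⊤) hS) s.1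
  let i : op (⊤ : Opens X) ⟶ op Z.compl := (homOfLE (le_top : Z.compl ≤ ⊤)).op
  have hs : S.X₃.obj.map i s.1 = 0 := s.2
  -- The lift `t` need not have support in `Z`. Off `Z` it comes from a section `r` of the flasque
  -- kernel; extend `r` to `X` and subtract.
  obtain ⟨r, hr⟩ := sections_exact_of_left_exact hS.exact hS.mono_f (S.X₂.obj.map i t)
    ((hom_naturality_apply S.g i t).trans (by rw [ht, hs]))
  obtain ⟨r', hr'⟩ := (AddCommGrpCat.epi_iff_surjective (S.X₁.obj.map i)).1
    (Presheaf.IsFlasque.epi i) r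
  have hfg : S.g.hom.app (op ⊤) (S.f.hom.app (op ⊤) r') = 0 := by
    have := congr_arg (fun φ => φ.hom.app (op ⊤) r') S.zero
    exact this
  have hmem : t - S.f.hom.app (op ⊤) r' ∈ sectionsWithSupport Z S.X₂ := by
    change S.X₂.obj.map i (t - S.f.hom.app (op ⊤) r') = 0
    rw [map_sub, ← hom_naturality_apply, hr', hr, sub_self]
  refine ⟨(freeClosedEquiv Z S.X₂).symm ⟨_, hmem⟩, ?_⟩
  apply (freeClosedEquiv Z S.X₃).injective
  apply Subtype.ext
  rw [freeClosedEquiv_comp, AddEquiv.apply_symm_apply, map_sub, hfg, ht, sub_zero]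

lemma exists_shortExact_injective_isFlasque (F : TopCat.Sheaf AddCommGrpCat.{u} X) [IsFlasque F] :
    ∃ (E Q : TopCat.Sheaf AddCommGrpCat.{u} X) (f : F ⟶ E) (g : E ⟶ Q) (w : f ≫ g = 0),
      (ShortComplex.mk f g w).ShortExact ∧ Injective E ∧ IsFlasque Q := by
  let S := ShortComplex.mk (Injective.ι F) (cokernel.π (Injective.ι F)) (cokernel.condition _)
  have hS : S.ShortExact := { exact := ShortComplex.exact_cokernel _ }
  have : IsFlasque S.X₁ := ‹_›
  have : IsFlasque S.X₂ := isFlasque_of_injective (Injective.under F)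
  exact ⟨_, _, _, _, _, hS, inferInstance, IsFlasque.of_shortExact_of_isFlasque₁₂ hS⟩

/-- Flasque sheaves have no higher cohomology with supports. -/
lemma subsingleton_ext_freeClosed_of_isFlasque (Z : Closeds X) (p : ℕ)
    (F : TopCat.Sheaf AddCommGrpCat.{u} X) [IsFlasque F] :
    Subsingleton (Ext (freeClosed Z) F (p + 1)) := by
  induction p generalizing F with
  | zero =>
    obtain ⟨E, Q, f, g, w, hS, _, _⟩ := exists_shortExact_injective_isFlasque F
    refine subsingleton_of_forall_eq 0 fun x => ?_
    obtain ⟨y, rfl⟩ := Ext.covariant_sequence_exact₁ _ hS x (Ext.eq_zero_of_injective _) rfl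
    obtain ⟨q, rfl⟩ := (Ext.mk₀_bijective _ _).surjective y
    have : IsFlasque (ShortComplex.mk f g w).X₁ := ‹IsFlasque F›
    -- The class is the connecting image of `q`, which vanishes once `q` lifts to `E`.
    obtain ⟨e, rfl⟩ := exists_lift_freeClosed Z hS q
    rw [← Ext.mk₀_comp_mk₀, Ext.comp_assoc (a₂₃ := 1) _ _ _ _ (by lia) (by lia), hS.comp_extClass,
      Ext.comp_zero]
  | succ p ih =>
    obtain ⟨E, Q, f, g, w, hS, _, _⟩ := exists_shortExact_injective_isFlasque F
    refine subsingleton_of_forall_eq 0 fun x => ?_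
    obtain ⟨y, rfl⟩ := Ext.covariant_sequence_exact₁ _ hS x (Ext.eq_zero_of_injective _) rfl
    rw [(ih Q).elim y 0, Ext.zero_comp]

end TopCat.Sheaf

/-! ### Exactness of `M ↦ M^~` in abelian sheaves. -/

namespace TopCat.Sheaf

open Limits

variable {X : TopCat.{u}}

/-- A complex of abelian sheaves is exact if every section of the middle term mapping to zero
comes locally from the first term. -/
lemma exact_of_locally (S : ShortComplex (TopCat.Sheaf AddCommGrpCat.{u} X))
    (h : ∀ (U : Opens X) (s : S.X₂.obj.obj (op U)), S.g.hom.app (op U) s = 0 → ∀ x ∈ U,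
      ∃ (V : Opens X) (i : V ⟶ U) (_ : x ∈ V) (t : S.X₁.obj.obj (op V)),
        S.f.hom.app (op V) t = S.X₂.obj.map i.op s) :
    S.Exact := by
  rw [exact_iff_stalkFunctor_map_exact]
  intro x
  rw [ShortComplex.ab_exact_iff]
  intro y (hy : (Presheaf.stalkFunctor AddCommGrpCat x).map S.g.hom y = 0)
  obtain ⟨U, hxU, s, rfl⟩ := Presheaf.exists_germ_eq S.X₂.obj y
  rw [Presheaf.stalkFunctor_map_germ_apply] at hy
  obtain ⟨W, hxW, i, j, hij⟩ := Presheaf.germ_eq S.X₃.obj x hxU hxU _ _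
    (hy.trans (map_zero (Presheaf.germ S.X₃.obj U x hxU).hom).symm)
  obtain ⟨V, k, hxV, t, ht⟩ := h W (S.X₂.obj.map i.op s)
    ((hom_naturality_apply S.g i.op s).trans (hij.trans (_root_.map_zero _))) x hxW
  refine ⟨Presheaf.germ S.X₁.obj V x hxV t, ?_⟩
  refine (Presheaf.stalkFunctor_map_germ_apply V x hxV S.f.hom t).trans ?_
  rw [ht, Presheaf.germ_res_apply, Presheaf.germ_res_apply]

end TopCat.Sheaf

namespace AlgebraicGeometry.tilde

open Limits

variable {R : CommRingCat.{u}}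

/-- The basic open subset `D(f)` of `Spec R`. -/
def specBasicOpen (f : R) : (Spec R).Opens := PrimeSpectrum.basicOpen f

section Sections

variable (M : ModuleCat.{u} R)

/-- The canonical map from `M` to the sections of `M^~` over `U`. -/
def toSections (U : (Spec R).Opens) : M →ₗ[R] Γ(tilde M, U) :=
  (tilde.toOpen M U).hom

variable {M}

lemma map_toSections {U V : (Spec R).Opens} (i : V ⟶ U) (m : M) :
    (tilde M).presheaf.map i.op (toSections M U m) = toSections M V m :=
  ConcreteCategory.congr_hom (tilde.toOpen_res M U V i) m

lemma toSections_top_bijective : Function.Bijective (toSections M ⊤) :=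
  (ConcreteCategory.isIso_iff_bijective (tilde.toOpen M ⊤)).1 inferInstance

instance isLocalizedModule_toSections (f : R) :
    IsLocalizedModule.Away f (toSections M (specBasicOpen f)) :=
  inferInstanceAs (IsLocalizedModule.Away f (tilde.toOpen M (PrimeSpectrum.basicOpen f)).hom)

lemma exists_pow_smul_eq_toSections (f : R) (s : Γ(tilde M, specBasicOpen f)) :
    ∃ (n : ℕ) (m : M), f ^ n • s = toSections M (specBasicOpen f) m := by
  obtain ⟨⟨m, ⟨_, n, rfl⟩⟩, h⟩ :=
    IsLocalizedModule.surj (.powers f) (toSections M (specBasicOpen f)) s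
  exact ⟨n, m, h⟩

lemma exists_pow_smul_eq_zero_of_toSections_eq_zero {f : R} {m : M}
    (h : toSections M (specBasicOpen f) m = 0) : ∃ n : ℕ, f ^ n • m = 0 := by
  obtain ⟨⟨_, n, rfl⟩, h⟩ := (IsLocalizedModule.eq_zero_iff (.powers f) _).1 h
  exact ⟨n, h⟩

variable (M) in
lemma pow_smul_bijective (f : R) (n : ℕ) : Function.Bijective
    fun s : Γ(tilde M, specBasicOpen f) => f ^ n • s :=
  (Module.End.isUnit_iff _).1 (IsLocalizedModule.map_units
    (toSections M (specBasicOpen f)) (⟨f ^ n, n, rfl⟩ : Submonoid.powers f))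

end Sections

variable (R) in
/-- The functor sending an `R`-module `M` to the abelian sheaf on `Spec R` underlying `M^~`. -/
def abFunctor :
    ModuleCat.{u} R ⥤ TopCat.Sheaf AddCommGrpCat.{u} (Spec R).toTopCat where
  obj M := ⟨(tilde M).presheaf, (tilde M).isSheaf⟩
  map f := ⟨(tilde.map f).mapPresheaf⟩
  map_id M := ObjectProperty.hom_ext _
    (congr_arg Scheme.Modules.Hom.mapPresheaf (tilde.map_id (M := M)))
  map_comp f g := ObjectProperty.hom_ext _
    (congr_arg Scheme.Modules.Hom.mapPresheaf (tilde.map_comp f g))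

instance : (abFunctor R).Additive where
  map_add {_ _ f g} := ObjectProperty.hom_ext _
    (congr_arg Scheme.Modules.Hom.mapPresheaf (tilde.map_add f g))

variable {M N : ModuleCat.{u} R} (f : M ⟶ N) (U : (Spec R).Opens)

lemma map_app_toSections (m : M) :
    (tilde.map f).app U (toSections M U m) = toSections N U (f m) :=
  ConcreteCategory.congr_hom (tilde.toOpen_map_app f U) m

lemma map_app_smul (a : R) (s : Γ(tilde M, U)) :
    (tilde.map f).app U (a • s) = a • (tilde.map f).app U s :=
  ((modulesSpecToSheaf.map (tilde.map f)).hom.app (op U)).hom.map_smul a s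

/-- The functor `M ↦ M^~` to abelian sheaves is exact. -/
lemma exact_abFunctor_map (S : ShortComplex (ModuleCat.{u} R)) (hS : S.Exact) :
    (S.map (abFunctor R)).Exact := by
  refine TopCat.Sheaf.exact_of_locally _ fun U s hs x hx => ?_
  obtain ⟨_, ⟨_, ⟨f, rfl⟩, rfl⟩, hxf, hfU : specBasicOpen f ≤ U⟩ :=
    PrimeSpectrum.isBasis_basic_opens.exists_subset_of_mem_open hx U.2
  refine ⟨_, homOfLE hfU, hxf, ?_⟩
  let s' : Γ(tilde S.X₂, specBasicOpen f) := (tilde S.X₂).presheaf.map (homOfLE hfU).op s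
  have hs' : (tilde.map S.g).app (specBasicOpen f) s' = 0 :=
    (TopCat.Sheaf.hom_naturality_apply ((abFunctor R).map S.g) (homOfLE hfU).op s).trans
      ((congr_arg _ hs).trans (_root_.map_zero _))
  -- Clear denominators on `D(f)`, use exactness in modules, then divide by `f ^ (k + n)`.
  obtain ⟨n, m, hm⟩ := exists_pow_smul_eq_toSections f s'
  obtain ⟨k, hk⟩ := exists_pow_smul_eq_zero_of_toSections_eq_zero (f := f) (m := S.g m) (by
    rw [← map_app_toSections, ← hm, map_app_smul, hs', smul_zero])
  rw [ShortComplex.moduleCat_exact_iff] at hS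
  obtain ⟨m₁, hm₁⟩ := hS (f ^ k • m) (by rw [_root_.map_smul, hk])
  obtain ⟨t, ht : f ^ (k + n) • t = _⟩ := (pow_smul_bijective S.X₁ f (k + n)).surjective
    (toSections S.X₁ _ m₁)
  refine ⟨t, (pow_smul_bijective S.X₂ f (k + n)).injective ?_⟩
  change f ^ (k + n) • (tilde.map S.f).app _ t = f ^ (k + n) • s'
  rw [← map_app_smul, ht, map_app_toSections, hm₁, _root_.map_smul, ← hm, pow_add, mul_smul]

lemma shortExact_abFunctor_map {S : ShortComplex (ModuleCat.{u} R)} (hS : S.ShortExact) :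
    (S.map (abFunctor R)).ShortExact :=
  (((abFunctor R).exact_tfae.out 1 0).1 exact_abFunctor_map :) S hS

end AlgebraicGeometry.tilde

/-! ### Flasqueness of `J^~` for an injective module `J`. -/

/-- If `J` is injective over a noetherian ring, a partially defined map to `J` given by a
correspondence `(φ, ψ)` whose ambiguity `ker φ` is `I`-power torsion is multiplication by an
element of `J` after restriction to a power of `I`. -/
lemma Module.Injective.exists_smul_eq_of_ker_torsion {R : Type u} [CommRing R] [IsNoetherianRing R]
    {J P : Type u} [AddCommGroup J] [Module R J] [Module.Injective R J] [AddCommGroup P]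
    [Module R P] [Module.Finite R P] (φ : P →ₗ[R] R) (ψ : P →ₗ[R] J) (t : Set R)
    (h : ∀ p, φ p = 0 → ∀ g ∈ t, ∃ n : ℕ, g ^ n • p = 0) :
    ∃ (q : ℕ) (j : J), ∀ p ∈ (Ideal.span t ^ q • ⊤ : Submodule R P), ψ p = φ p • j := by
  let I := Ideal.span t
  obtain ⟨c, hc⟩ : ∃ c : ℕ, I ^ c ≤ (LinearMap.ker φ).annihilator := by
    refine Ideal.exists_pow_le_of_le_radical_of_fg (Ideal.span_le.2 fun g hg => ?_)
      (IsNoetherian.noetherian I)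
    obtain ⟨S, hS⟩ := IsNoetherian.noetherian (LinearMap.ker φ)
    have hS' : ∀ p ∈ S, φ p = 0 := fun p hp =>
      (hS ▸ Submodule.subset_span hp : p ∈ LinearMap.ker φ)
    choose! n hn using fun p (hp : φ p = 0) => h p hp g hg
    refine ⟨S.sup n, ?_⟩
    rw [← hS, Submodule.mem_annihilator_span]
    rintro ⟨p, hp⟩
    obtain ⟨d, hd⟩ := Nat.exists_eq_add_of_le (Finset.le_sup (f := n) hp)
    rw [hd, add_comm, pow_add, mul_smul, hn p (hS' p hp), smul_zero]
  -- Artin–Rees: `I^(k+c) P ∩ ker φ = I^c (I^k P ∩ ker φ) = 0`, so `φ` is injective on `I^(k+c) P`.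
  -- There `ψ` factors through `φ`, and the factor extends to a map `R → J`, determined by its value
  -- at `1`.
  obtain ⟨k, hk⟩ := Ideal.exists_pow_inf_eq_pow_smul I (LinearMap.ker φ)
  let L : Submodule R P := I ^ (k + c) • ⊤
  have hL : Function.Injective (φ.comp L.subtype) := by
    rw [← LinearMap.ker_eq_bot, eq_bot_iff]
    intro p hp
    have h₁ : (p : P) ∈ I ^ (k + c) • ⊤ ⊓ LinearMap.ker φ := ⟨p.2, hp⟩
    rw [hk _ (by lia), Nat.add_sub_cancel_left] at h₁
    have h₂ : (p : P) ∈ (⊥ : Submodule R P) := by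
      refine (?_ : I ^ c • (I ^ k • ⊤ ⊓ LinearMap.ker φ) ≤ ⊥) h₁
      rw [Submodule.smul_le]
      exact fun r hr n hn => (Submodule.mem_bot R).2 (Submodule.mem_annihilator.1 (hc hr) n hn.2)
    exact (Submodule.mem_bot R).2 (Subtype.ext ((Submodule.mem_bot R).1 h₂))
  obtain ⟨e, he⟩ := Module.Injective.out (φ.comp L.subtype) hL (ψ.comp L.subtype)
  refine ⟨k + c, e 1, fun p hp => ?_⟩
  rw [← map_smul, smul_eq_mul, mul_one]
  exact (he ⟨p, hp⟩).symm

lemma PrimeSpectrum.exists_finset_forall_mem_iff {R : Type u} [CommRing R] [IsNoetherianRing R]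
    (U : Opens (PrimeSpectrum R)) :
    ∃ T : Finset R, ∀ x : PrimeSpectrum R, x ∈ U ↔ ∃ g ∈ T, g ∉ x.asIdeal := by
  obtain ⟨t, ht⟩ := (PrimeSpectrum.isOpen_iff U.1).1 U.2
  obtain ⟨T, hT : Ideal.span (T : Set R) = _⟩ := IsNoetherian.noetherian (Ideal.span t)
  refine ⟨T, fun x => ?_⟩
  rw [← PrimeSpectrum.zeroLocus_span, ← hT, PrimeSpectrum.zeroLocus_span] at ht
  change x ∈ U.1 ↔ _
  rw [← not_iff_not, ← Set.mem_compl_iff, ht, PrimeSpectrum.mem_zeroLocus]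
  push Not
  rfl

namespace AlgebraicGeometry.tilde

open Limits

variable {R : CommRingCat.{u}} {M : ModuleCat.{u} R}

lemma presheaf_map_smul {U V : (Spec R).Opens} (i : V ⟶ U) (a : R) (s : Γ(tilde M, U)) :
    (tilde M).presheaf.map i.op (a • s) = a • (tilde M).presheaf.map i.op s :=
  Scheme.Modules.map_smul_Spec i.op a s

lemma map_map {U V W : (Spec R).Opens} (i : V ⟶ U) (j : W ⟶ V) (k : W ⟶ U) (s : Γ(tilde M, U)) :
    (tilde M).presheaf.map j.op ((tilde M).presheaf.map i.op s) =
      (tilde M).presheaf.map k.op s :=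
  (ConcreteCategory.congr_hom ((tilde M).presheaf.map_comp i.op j.op) s).symm

/-- Sections over `U` agree if they agree on the members of a cover by basic open subsets. -/
lemma section_ext {U : (Spec R).Opens} {t : Set R}
    (hU : ∀ x ∈ U, ∃ g ∈ t, x ∈ specBasicOpen g)
    (hD : ∀ g ∈ t, specBasicOpen g ≤ U) {s s' : Γ(tilde M, U)}
    (h : ∀ g (hg : g ∈ t), (tilde M).presheaf.map (homOfLE (hD g hg)).op s =
      (tilde M).presheaf.map (homOfLE (hD g hg)).op s') : s = s' := by
  refine TopCat.Presheaf.IsSheaf.section_ext (tilde M).isSheaf fun x hx => ?_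
  obtain ⟨g, hg, hgx⟩ := hU x hx
  exact ⟨_, hD g hg, hgx, h g hg⟩

/-- A power of `f` times a section over `U ⊇ D(f)` comes from `M`. -/
lemma exists_pow_smul_eq_toSections_of_finite {U : (Spec R).Opens} {t : Set R} (ht : t.Finite)
    (hU : ∀ x ∈ U, ∃ g ∈ t, x ∈ specBasicOpen g) (hD : ∀ g ∈ t, specBasicOpen g ≤ U)
    {f : R} (hf : f ∈ t) (s : Γ(tilde M, U)) :
    ∃ (n : ℕ) (m : M), f ^ n • s = toSections M U m := by
  obtain ⟨n, m, hm⟩ := exists_pow_smul_eq_toSections f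
    ((tilde M).presheaf.map (homOfLE (hD f hf)).op s)
  let d : Γ(tilde M, U) := f ^ n • s - toSections M U m
  have hd : (tilde M).presheaf.map (homOfLE (hD f hf)).op d = 0 := by
    rw [_root_.map_sub, presheaf_map_smul, hm, map_toSections, sub_self]
  -- On `D(g)` write `g^j d = m'`. Since `d` vanishes on `D(fg)`, some `(fg)^k` kills `m'`, and `g`
  -- is invertible on `D(g)`.
  have key (g : R) (hg : g ∈ t) :
      ∃ k : ℕ, f ^ k • (tilde M).presheaf.map (homOfLE (hD g hg)).op d = 0 := by
    obtain ⟨j, m', hm'⟩ := exists_pow_smul_eq_toSections g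
      ((tilde M).presheaf.map (homOfLE (hD g hg)).op d)
    have h₁ : specBasicOpen (f * g) ≤ specBasicOpen f := PrimeSpectrum.basicOpen_mul_le_left f g
    have h₂ : specBasicOpen (f * g) ≤ specBasicOpen g := PrimeSpectrum.basicOpen_mul_le_right f g
    obtain ⟨k, hk⟩ := exists_pow_smul_eq_zero_of_toSections_eq_zero (f := f * g) (m := m') (by
      rw [← map_toSections (homOfLE h₂), ← hm', presheaf_map_smul,
        map_map _ _ (homOfLE (h₂.trans (hD g hg))), ← map_map (homOfLE (hD f hf)) (homOfLE h₁), hd,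
        _root_.map_zero, smul_zero])
    refine ⟨k, (pow_smul_bijective M g (k + j)).injective ?_⟩
    dsimp only
    rw [smul_comm, pow_add, mul_smul, hm', ← mul_smul, ← mul_pow, ← _root_.map_smul, hk,
      _root_.map_zero, smul_zero]
  choose! k hk using key
  refine ⟨ht.toFinset.sup k + n, f ^ (ht.toFinset.sup k) • m, ?_⟩
  have : f ^ ht.toFinset.sup k • d = 0 := by
    refine section_ext hU hD fun g hg => ?_
    obtain ⟨e, he⟩ := Nat.exists_eq_add_of_le (Finset.le_sup (f := k) (ht.mem_toFinset.2 hg))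
    rw [presheaf_map_smul, he, add_comm, pow_add, mul_smul, hk g hg, smul_zero, _root_.map_zero]
  rw [pow_add, mul_smul, _root_.map_smul, ← sub_eq_zero, ← smul_sub]
  exact this

lemma exists_finite_cover_specBasicOpen [IsNoetherianRing R] (U : (Spec R).Opens) :
    ∃ t : Set R, t.Finite ∧ (∀ x ∈ U, ∃ g ∈ t, x ∈ specBasicOpen g) ∧
      ∀ g ∈ t, specBasicOpen g ≤ U := by
  obtain ⟨T, hx⟩ := PrimeSpectrum.exists_finset_forall_mem_iff (R := R) U
  exact ⟨T, T.finite_toSet, fun x h => (hx x).1 h, fun g hg x h => (hx x).2 ⟨g, hg, h⟩⟩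

/-- If `J` is an injective module over a noetherian ring, every section of `J^~` over an open
subset comes from `J`. -/
lemma toSections_surjective_of_injective [IsNoetherianRing R] (J : ModuleCat.{u} R)
    [Module.Injective R J] (U : (Spec R).Opens) : Function.Surjective (toSections J U) := by
  intro s
  obtain ⟨t, ht, hU, hD⟩ := exists_finite_cover_specBasicOpen U
  choose! n m hnm using fun f (hf : f ∈ t) =>
    exists_pow_smul_eq_toSections_of_finite ht hU hD hf s
  -- `N` is a correspondence for the partial map `x ↦ x • s` from `R` to `J`. Its ambiguity consists
  -- of `y` vanishing on `U`, hence torsion for every `g ∈ t`.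
  let N : Submodule R (R × J) := Submodule.span R ((fun f => (f ^ n f, m f)) '' t)
  have hN : ∀ p ∈ N, p.1 • s = toSections J U p.2 := by
    intro p hp
    induction hp using Submodule.span_induction with
    | mem p hp => obtain ⟨f, hf, rfl⟩ := hp; exact hnm f hf
    | zero => simp
    | add p q _ _ hp hq => simp [add_smul, hp, hq]
    | smul a p _ hp => simp [mul_smul, hp]
  have : Module.Finite R N := Module.Finite.span_of_finite R (ht.image _)
  obtain ⟨q, j, hj⟩ := Module.Injective.exists_smul_eq_of_ker_torsion
    ((LinearMap.fst R R J).comp N.subtype) ((LinearMap.snd R R J).comp N.subtype) t (by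
      rintro ⟨⟨x, y⟩, hp⟩ (rfl : x = 0) g hg
      have hy : toSections J U y = 0 := by simpa using (hN _ hp).symm
      obtain ⟨k, hk⟩ := exists_pow_smul_eq_zero_of_toSections_eq_zero (f := g) (m := y) (by
        rw [← map_toSections (homOfLE (hD g hg)), hy, _root_.map_zero])
      exact ⟨k, by ext <;> simp [hk]⟩)
  refine ⟨j, section_ext hU hD fun f hf => ?_⟩
  let p : N := ⟨_, Submodule.subset_span ⟨f, hf, rfl⟩⟩
  have hp := hj (f ^ q • p)
    (Submodule.smul_mem_smul (Ideal.pow_mem_pow (Ideal.subset_span hf) q) trivial)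
  have hp' : f ^ q • m f = (f ^ q * f ^ n f) • j := hp
  apply (pow_smul_bijective J f (q + n f)).injective
  dsimp only
  rw [← presheaf_map_smul, ← presheaf_map_smul, ← _root_.map_smul, pow_add, ← hp',
    mul_smul, hnm f hf, _root_.map_smul]

lemma isFlasque_abFunctor_obj [IsNoetherianRing R] (J : ModuleCat.{u} R)
    [Module.Injective R J] : TopCat.Sheaf.IsFlasque ((abFunctor R).obj J) where
  epi {U V} i := by
    refine (AddCommGrpCat.epi_iff_surjective _).2 fun s => ?_
    obtain ⟨j, rfl⟩ := toSections_surjective_of_injective J V.unop s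
    exact ⟨toSections J U.unop j, map_toSections i.unop j⟩

end AlgebraicGeometry.tilde

/-! ### Torsion and long exact sequences for local cohomology. -/

namespace AlgebraicGeometry.tilde

open Limits Abelian TopCat.Sheaf

variable {R : CommRingCat.{u}} {Z : Closeds (Spec R).toTopCat}

variable (Z) in
/-- The groups `Ext^p(ℤ_Z, M^~)`, which compute the cohomology of `M^~` with support in `Z`. -/
abbrev LocalExt (M : ModuleCat.{u} R) (p : ℕ) : Type u :=
  Ext (freeClosed Z) ((abFunctor R).obj M) p

/-- The map on `LocalExt` induced by a linear map. -/
abbrev LocalExt.map {M N : ModuleCat.{u} R} (f : M ⟶ N) {p : ℕ} (x : LocalExt Z M p) :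
    LocalExt Z N p :=
  x.comp (Ext.mk₀ ((abFunctor R).map f)) (add_zero p)

/-- Sections with support in `Z` are `a`-power torsion if `D(a)` does not meet `Z`. -/
lemma exists_pow_smul_comp_eq_zero {M : ModuleCat.{u} R} {a : R} (ha : specBasicOpen a ≤ Z.compl)
    (φ : freeClosed Z ⟶ (abFunctor R).obj M) :
    ∃ k : ℕ, φ ≫ (abFunctor R).map (a ^ k • 𝟙 M) = 0 := by
  let s := freeClosedEquiv _ _ φ
  obtain ⟨m, hm⟩ := (toSections_top_bijective (M := M)).2 s.1
  have hs : (tilde M).presheaf.map (homOfLE (le_top : Z.compl ≤ ⊤)).op s.1 = 0 := s.2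
  rw [← hm, map_toSections] at hs
  obtain ⟨k, hk⟩ := exists_pow_smul_eq_zero_of_toSections_eq_zero (f := a) (m := m) (by
    rw [← map_toSections (homOfLE ha), hs, _root_.map_zero])
  refine ⟨k, (freeClosedEquiv Z ((abFunctor R).obj M)).injective (Subtype.ext ?_)⟩
  rw [_root_.map_zero]
  refine (freeClosedEquiv_comp _ _).trans ?_
  change (tilde.map (a ^ k • 𝟙 M)).app ⊤ s.1 = 0
  rw [← hm, map_app_toSections]
  exact (congr_arg _ hk).trans (_root_.map_zero _)

/-- If `H^0_Z(M^~) = 0`, where `Z = V(I)`, then an element of `M` killed by `I` vanishes. -/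
lemma eq_zero_of_forall_smul_eq_zero {M : ModuleCat.{u} R} {I : Ideal R}
    (hI : ∀ a ∈ I, specBasicOpen a ≤ Z.compl)
    (hZ : ∀ x ∈ Z.compl, ∃ a ∈ I, x ∈ specBasicOpen a)
    (h : Subsingleton (LocalExt Z M 0)) {m : M} (hm : ∀ a ∈ I, a • m = 0) : m = 0 := by
  have hs : toSections M ⊤ m ∈ sectionsWithSupport Z ((abFunctor R).obj M) := by
    refine (map_toSections (homOfLE (le_top : Z.compl ≤ ⊤)) m).trans ?_
    refine section_ext (t := (I : Set R)) hZ hI fun a ha => ?_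
    rw [map_toSections]
    refine Eq.trans ?_ (_root_.map_zero ((tilde M).presheaf.map (homOfLE (hI a ha)).op).hom).symm
    -- `a` kills `m` but is invertible on `D(a)`, so `m` vanishes there.
    apply (pow_smul_bijective M a 1).injective
    dsimp only
    rw [← _root_.map_smul, pow_one, hm a ha, _root_.map_zero, smul_zero]
  rw [Ext.subsingleton_zero_iff] at h
  have := (freeClosedEquiv Z ((abFunctor R).obj M)).symm.injective
    (h.elim ((freeClosedEquiv Z ((abFunctor R).obj M)).symm ⟨_, hs⟩)
      ((freeClosedEquiv Z ((abFunctor R).obj M)).symm 0))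
  apply toSections_top_bijective.1
  rw [_root_.map_zero]
  exact congr_arg Subtype.val this

/-- Cohomology with support in `Z` is `a`-power torsion if `D(a)` does not meet `Z`. -/
lemma LocalExt.exists_map_pow_smul_eq_zero [IsNoetherianRing R] {a : R}
    (ha : specBasicOpen a ≤ Z.compl) (p : ℕ) (M : ModuleCat.{u} R) (x : LocalExt Z M p) :
    ∃ k : ℕ, x.map (a ^ k • 𝟙 M) = 0 := by
  induction p generalizing M with
  | zero =>
    obtain ⟨φ, rfl⟩ := (Ext.mk₀_bijective _ _).surjective x
    obtain ⟨k, hk⟩ := exists_pow_smul_comp_eq_zero ha φ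
    refine ⟨k, ?_⟩
    rw [LocalExt.map, Ext.mk₀_comp_mk₀, hk, Ext.mk₀_zero]
  | succ p ih =>
    let S := ShortComplex.mk (Injective.ι M) (cokernel.π (Injective.ι M)) (cokernel.condition _)
    have hS : S.ShortExact := { exact := ShortComplex.exact_cokernel _ }
    have hS' := shortExact_abFunctor_map hS
    have : Module.Injective R S.X₂ :=
      (Module.injective_iff_injective_object R S.X₂).2
        (inferInstanceAs (Injective (Injective.under M)))
    have : IsFlasque (S.map (abFunctor R)).X₂ := isFlasque_abFunctor_obj S.X₂
    obtain ⟨y, rfl⟩ := Ext.covariant_sequence_exact₁ _ hS' x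
      ((subsingleton_ext_freeClosed_of_isFlasque _ p _).elim _ _) rfl
    obtain ⟨k, hk⟩ := ih S.X₃ y
    refine ⟨k, ?_⟩
    -- Multiplication by `a ^ k` acts on the whole sequence, so it commutes with the connecting map
    -- and the power killing `y` also kills `x`.
    let φ : S ⟶ S :=
      { τ₁ := a ^ k • 𝟙 _, τ₂ := a ^ k • 𝟙 _, τ₃ := a ^ k • 𝟙 _ }
    have := hS'.extClass_naturality hS' ((abFunctor R).mapShortComplex.map φ)
    refine (Ext.comp_assoc (a₂₃ := 1) _ _ _ _ (by lia) (by lia)).trans ?_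
    refine (congr_arg (fun z => y.comp z rfl) this).trans ?_
    rw [← Ext.comp_assoc (a₁₂ := p) _ _ _ (by lia) (by lia) (by lia)]
    refine (congr_arg (fun z => Ext.comp z _ _) hk).trans (Ext.zero_comp _ _ _ _ _)

/-- If `D(a)` does not meet `Z` and `a` acts injectively on `H^p_Z(M^~)`, then this group
vanishes. -/
lemma LocalExt.subsingleton_of_map_smul_injective [IsNoetherianRing R] {a : R}
    (ha : specBasicOpen a ≤ Z.compl) {p : ℕ} {M : ModuleCat.{u} R}
    (h : ∀ x : LocalExt Z M p, x.map (a • 𝟙 M) = 0 → x = 0) : Subsingleton (LocalExt Z M p) := by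
  refine subsingleton_of_forall_eq 0 fun x => ?_
  obtain ⟨k, hk⟩ := exists_map_pow_smul_eq_zero ha p M x
  induction k with
  | zero => simpa [LocalExt.map] using hk
  | succ k ih =>
    refine ih (h _ ?_)
    rw [← hk, LocalExt.map, LocalExt.map, Ext.comp_assoc (a₂₃ := 0) _ _ _ _ (by lia) (by lia),
      Ext.mk₀_comp_mk₀, ← Functor.map_comp, Linear.smul_comp, Linear.comp_smul, Category.id_comp,
      smul_smul, ← pow_succ]

section Regular

variable {M : ModuleCat.{u} R} {a : R} (h : IsSMulRegular M a)

include h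

/-- The long exact sequence makes `a` injective on a group that is `a`-power torsion. Writing the
degree as `q + 1 = p` leaves no condition when `p = 0`. -/
lemma LocalExt.subsingleton_of_quotSMulTop [IsNoetherianRing R] (ha : specBasicOpen a ≤ Z.compl)
    {p : ℕ} (hp : ∀ q, q + 1 = p → Subsingleton (LocalExt Z (.of R (QuotSMulTop a M)) q)) :
    Subsingleton (LocalExt Z M p) := by
  have hS := shortExact_abFunctor_map h.smulShortComplex_shortExact
  refine subsingleton_of_map_smul_injective ha fun x hx => ?_
  cases p with
  | zero =>
    have := hS.mono_f
    exact Ext.postcomp_mk₀_injective_of_mono _ ((M.smulShortComplex a).map (abFunctor R)).f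
      (hx.trans (_root_.map_zero ((Ext.mk₀ _).postcomp _ _)).symm)
  | succ p =>
    obtain ⟨y, rfl⟩ := Ext.covariant_sequence_exact₁ _ hS x hx rfl
    have hy : y = 0 := (hp p rfl).elim _ _
    rw [hy, Ext.zero_comp]
    rfl

/-- In the long exact sequence the group for `M/aM` sits between the two vanishing ones. -/
lemma LocalExt.subsingleton_quotSMulTop {p : ℕ} (h₁ : Subsingleton (LocalExt Z M p))
    (h₂ : Subsingleton (LocalExt Z M (p + 1))) :
    Subsingleton (LocalExt Z (.of R (QuotSMulTop a M)) p) := by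
  have hS := shortExact_abFunctor_map h.smulShortComplex_shortExact
  refine subsingleton_of_forall_eq 0 fun x => ?_
  obtain ⟨y, rfl⟩ := Ext.covariant_sequence_exact₃ _ hS x rfl (h₂.elim _ _)
  have hy : y = 0 := h₁.elim _ _
  rw [hy, Ext.zero_comp]
  rfl

end Regular

end AlgebraicGeometry.tilde

/-! ### Existence of regular elements and of maximal regular sequences. -/

section RegularSequences

open RingTheory.Sequence

variable {A : Type*} [CommRing A] {I : Ideal A} {M : Type*} [AddCommGroup M] [Module A M]

lemma isRegularSeqIn_nil : IsRegularSeqIn I M [] :=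
  ⟨by simp, .nil A M⟩

lemma isRegularSeqIn_cons_iff {r : A} {rs : List A} :
    IsRegularSeqIn I M (r :: rs) ↔
      r ∈ I ∧ IsSMulRegular M r ∧ IsRegularSeqIn I (QuotSMulTop r M) rs := by
  simp only [IsRegularSeqIn, List.forall_mem_cons, isWeaklyRegular_cons_iff]
  tauto

/-- An ideal of a noetherian ring which annihilates no nonzero element of a finite module contains
an element regular on that module. -/
lemma exists_mem_isSMulRegular [IsNoetherianRing A] [Module.Finite A M]
    (h : ∀ m : M, (∀ a ∈ I, a • m = 0) → m = 0) : ∃ a ∈ I, IsSMulRegular M a := by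
  by_contra! hI
  have hsub : (I : Set A) ⊆ ⋃ p ∈ ((associatedPrimes.finite A M).toFinset : Set (Ideal A)), p := by
    rw [Set.Finite.coe_toFinset, biUnion_associatedPrimes_eq_compl_regular]
    exact hI
  -- Prime avoidance permits two non-prime indices; all ideals here are prime, so `⊥ ⊥` are dummies.
  obtain ⟨p, hp, hIp⟩ := (Ideal.subset_union_prime (f := fun p : Ideal A => p) ⊥ ⊥
    (fun p hp _ _ => ((associatedPrimes.finite A M).mem_toFinset.1 hp).isPrime)).1 hsub
  obtain ⟨hp', m, rfl⟩ :=
    isAssociatedPrime_iff.1 ((associatedPrimes.finite A M).mem_toFinset.1 hp)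
  refine hp'.ne_top ((Ideal.eq_top_iff_one _).2 ?_)
  rw [Submodule.mem_colon_singleton, one_smul]
  exact h m fun a ha => by simpa using hIp ha

/-- Over a noetherian module, some regular sequence in `I` is maximal. -/
lemma exists_isMaximalRegularSeqIn [IsNoetherian A M] (hIM : I • (⊤ : Submodule A M) ≠ ⊤) :
    ∃ rs : List A, IsMaximalRegularSeqIn I M rs := by
  let P : Set (Submodule A M) := {N | ∃ rs, IsRegularSeqIn I M rs ∧ Ideal.ofList rs • ⊤ = N}
  obtain ⟨_, ⟨rs, hrs, rfl⟩, hmax⟩ := set_has_maximal_iff_noetherian.2 ‹IsNoetherian A M› P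
    ⟨_, [], isRegularSeqIn_nil, rfl⟩
  refine ⟨rs, hrs, fun a ha => hIM ?_⟩
  -- By maximality of `(rs)M`, appending `a` gives `aM ⊆ (rs)M`. As `a` is regular on `M/(rs)M`,
  -- this forces `M = (rs)M ⊆ IM`.
  have hle : Ideal.ofList (rs ++ [a]) • (⊤ : Submodule A M) ≤ Ideal.ofList rs • ⊤ :=
    not_lt_iff_le_imp_ge.1 (hmax _ ⟨_, ha, rfl⟩)
      (Submodule.smul_mono_left (by rw [Ideal.ofList_append]; exact le_sup_left))
  have hreg : IsSMulRegular (M ⧸ Ideal.ofList rs • (⊤ : Submodule A M)) a :=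
    (isWeaklyRegular_singleton_iff _ a).1 ((isWeaklyRegular_append_iff M rs [a]).1 ha.2).2
  rw [eq_top_iff]
  intro m _
  have hm : m ∈ Ideal.ofList rs • (⊤ : Submodule A M) := by
    rw [← Submodule.Quotient.mk_eq_zero]
    apply hreg
    dsimp only
    rw [smul_zero, ← Submodule.Quotient.mk_smul, Submodule.Quotient.mk_eq_zero]
    exact hle (Submodule.smul_mem_smul (Ideal.subset_span (by simp)) trivial)
  exact Submodule.smul_mono_left (Ideal.span_le.2 hrs.1) hm

end RegularSequences

/-! ### Regular sequences against vanishing of local cohomology. -/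

namespace AlgebraicGeometry.tilde

open TopCat.Sheaf

variable {R : CommRingCat.{u}} [IsNoetherianRing R] {Z : Closeds (Spec R).toTopCat}
  {I : Ideal R} (hI : ∀ a ∈ I, specBasicOpen a ≤ Z.compl)

include hI

lemma LocalExt.subsingleton_of_isRegularSeqIn {rs : List R} {M : ModuleCat.{u} R}
    (h : IsRegularSeqIn I M rs) {p : ℕ} (hp : p < rs.length) : Subsingleton (LocalExt Z M p) := by
  induction rs generalizing M p with
  | nil => simp at hp
  | cons r rs ih =>
    obtain ⟨hr, hrM, hrs⟩ := isRegularSeqIn_cons_iff.1 h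
    refine subsingleton_of_quotSMulTop hrM (hI r hr) fun q hq => ih hrs ?_
    rw [List.length_cons] at hp
    lia

/-- Passing to `M/rM` costs one degree of vanishing and one term of the sequence; at the empty
sequence `H^0 = 0` supplies a regular element. -/
lemma LocalExt.exists_isRegularSeqIn_append (hZ : ∀ x ∈ Z.compl, ∃ a ∈ I, x ∈ specBasicOpen a)
    {rs : List R} {M : ModuleCat.{u} R} [Module.Finite R M] (h : IsRegularSeqIn I M rs)
    (hM : ∀ p ≤ rs.length, Subsingleton (LocalExt Z M p)) :
    ∃ a, IsRegularSeqIn I M (rs ++ [a]) := by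
  induction rs generalizing M with
  | nil =>
    obtain ⟨a, ha, haM⟩ := exists_mem_isSMulRegular
      fun m hm => eq_zero_of_forall_smul_eq_zero hI hZ (hM 0 le_rfl) (m := m) hm
    exact ⟨a, isRegularSeqIn_cons_iff.2 ⟨ha, haM, isRegularSeqIn_nil⟩⟩
  | cons r rs ih =>
    obtain ⟨hr, hrM, hrs⟩ := isRegularSeqIn_cons_iff.1 h
    have : Module.Finite R (ModuleCat.of R (QuotSMulTop r M)) :=
      inferInstanceAs (Module.Finite R (QuotSMulTop r M))
    rw [List.length_cons] at hM
    obtain ⟨a, ha⟩ := ih (M := .of R (QuotSMulTop r M)) hrs fun p hp =>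
      subsingleton_quotSMulTop hrM (hM p (by lia)) (hM (p + 1) (by lia))
    exact ⟨a, isRegularSeqIn_cons_iff.2 ⟨hr, hrM, ha⟩⟩

end AlgebraicGeometry.tilde

open AlgebraicGeometry tilde TopCat.Sheaf in
lemma isZero_sheafLocalCohomology_iff {A : Type u} [CommRing A] (I : Ideal A) (M : Type u)
    [AddCommGroup M] [Module A M] (p : ℕ) :
    Limits.IsZero (sheafLocalCohomology I M p) ↔
      Subsingleton (LocalExt (R := CommRingCat.of A) (closedZeroLocus I) (ModuleCat.of A M) p) :=
  isZero_cohomologyWithSupport_iff (closedZeroLocus I) (tildeAbSheaf M) p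

open AlgebraicGeometry tilde in
lemma isZero_sheafLocalCohomology_of_isRegularSeqIn {A : Type u} [CommRing A] [IsNoetherianRing A]
    {I : Ideal A} {M : Type u} [AddCommGroup M] [Module A M] {rs : List A}
    (h : IsRegularSeqIn I M rs) {p : ℕ} (hp : p < rs.length) :
    Limits.IsZero (sheafLocalCohomology I M p) :=
  (isZero_sheafLocalCohomology_iff I M p).2
    (LocalExt.subsingleton_of_isRegularSeqIn (R := CommRingCat.of A) (M := ModuleCat.of A M)
      (Z := closedZeroLocus I) (fun _ ha _ hx h => hx (h ha)) h hp)

open AlgebraicGeometry tilde in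
lemma exists_isRegularSeqIn_append_of_isZero {A : Type u} [CommRing A] [IsNoetherianRing A]
    {I : Ideal A} {M : Type u} [AddCommGroup M] [Module A M] [Module.Finite A M] {rs : List A}
    (h : IsRegularSeqIn I M rs)
    (hM : ∀ p ≤ rs.length, Limits.IsZero (sheafLocalCohomology I M p)) :
    ∃ a, IsRegularSeqIn I M (rs ++ [a]) := by
  have : Module.Finite (CommRingCat.of A) (ModuleCat.of A M) := ‹_›
  exact LocalExt.exists_isRegularSeqIn_append (R := CommRingCat.of A) (M := ModuleCat.of A M)
    (Z := closedZeroLocus I) (fun _ ha _ hx h => hx (h ha)) (fun _ hx => Set.not_subset.1 hx) h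
    fun p hp => (isZero_sheafLocalCohomology_iff I M p).1 (hM p hp)

end

theorem mainTheorem11 {A : Type u} [CommRing A] [IsNoetherianRing A]
    {M : Type u} [AddCommGroup M] [Module A M] [Module.Finite A M]
    (I : Ideal A) (hIM : I • (⊤ : Submodule A M) ≠ ⊤) :
    ((∃ rs : List A, IsMaximalRegularSeqIn I M rs) ∧
      ∀ rs : List A, IsMaximalRegularSeqIn I M rs → (rs.length : ℕ∞) = depth I M) ∧
    ∀ n : ℕ, (n : ℕ∞) ≤ depth I M ↔
      ∀ p : ℕ, p < n → Limits.IsZero (sheafLocalCohomology I M p) := by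
  have hlen : ∀ rs, IsMaximalRegularSeqIn I M rs → (rs.length : ℕ∞) = depth I M := by
    refine fun rs hrs => le_antisymm (le_iSup₂_of_le rs hrs.1 le_rfl) (iSup₂_le fun rs' hrs' => ?_)
    -- A longer sequence `rs'` would force vanishing in all degrees up to `rs.length`, so `rs` would
    -- extend.
    by_contra! hlt
    obtain ⟨a, ha⟩ := exists_isRegularSeqIn_append_of_isZero hrs.1 fun p hp =>
      isZero_sheafLocalCohomology_of_isRegularSeqIn hrs' (hp.trans_lt (Nat.cast_lt.1 hlt))
    exact hrs.2 a ha
  obtain ⟨rs, hrs⟩ := exists_isMaximalRegularSeqIn (A := A) (M := M) hIM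
  refine ⟨⟨⟨rs, hrs⟩, hlen⟩, fun n => ?_⟩
  rw [← hlen rs hrs, Nat.cast_le]
  refine ⟨fun hn p hp => isZero_sheafLocalCohomology_of_isRegularSeqIn hrs.1 (hp.trans_le hn),
    fun h => ?_⟩
  by_contra! hlt
  obtain ⟨a, ha⟩ := exists_isRegularSeqIn_append_of_isZero hrs.1 fun p hp => h p (hp.trans_lt hlt)
  exact hrs.2 a ha
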